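/- Let $G=H_3(\mathbb{Z})$ be the discrete Heisenberg group, i.e. $\mathbb{Z}^3$ with the product $(x_0,y_0,z_0)(x,y,z)=(x_0+x,\,y_0+y,\,z_0+z+x_0y)$, and let $a=(1,0,0)$, $b=(0,1,0)$, $c=(0,0,1)$. A function $h:G\to\mathbb{R}$ is called positive if $h(g)\ge 0$ for all $g\in G$ and $h\neq 0$. It is called $\mu_0$-harmonic, for $\mu_0=\delta_{a^{-1}}+\delta_{b^{-1}}$, if $h(g)=h(a^{-1}g)+h(b^{-1}g)$ for all $g\in G$. A positive $\mu_0$-harmonic function is called extremal if it is not the sum of two non-proportional positive $\mu_0$-harmonic functions. A character of $G$ is a group homomorphism $\chi:G\to\mathbb{R}_{>0}$. Consider the decay condition $$\lim_{n\to\infty}h(a^{-n}g_0)=\lim_{n\to\infty}h(b^{-n}g_0)=0\quad\text{for all } g_0\in G.\qquad(*)$$ 1. The center of $G$ is $Z=c^{\mathbb{Z}}$, and every positive $\mu_0$-harmonic function $h$ on $G$ satisfying $(*)$ is invariant under $Z$: $h(gk)=h(g)$ for all $g\in G$ and $k\in Z$. 2. Every extremal positive $\mu_0$-harmonic function $h$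 on $G$ satisfying $(*)$ is a character up to scaling: $h=t\chi$ for some real $t>0$ and some character $\chi$ of $G$. 3. Every $\mu_0$-harmonic character of $G$ is an extremal positive $\mu_0$-harmonic function. -/

import Mathlib

open Filter Topology

/-- The discrete Heisenberg group `H₃(ℤ)`: the triple `(x, y, z)` stands for the
upper unitriangular integer matrix with rows `(1, x, z)`, `(0, 1, y)`, `(0, 0, 1)`. -/
@[ext]
structure Heisenberg where
  x : ℤ
  y : ℤ
  z : ℤ

namespace Heisenberg

/-- The product is matrix multiplication:
`(x₀, y₀, z₀) (x, y, z) = (x₀ + x, y₀ + y, z₀ + z + x₀ y)`. -/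
instance : Mul Heisenberg :=
  ⟨fun g h => ⟨g.x + h.x, g.y + h.y, g.z + h.z + g.x * h.y⟩⟩

instance : One Heisenberg := ⟨⟨0, 0, 0⟩⟩

instance : Inv Heisenberg := ⟨fun g => ⟨-g.x, -g.y, -g.z + g.x * g.y⟩⟩

@[simp] theorem mul_x (g h : Heisenberg) : (g * h).x = g.x + h.x := rfl
@[simp] theorem mul_y (g h : Heisenberg) : (g * h).y = g.y + h.y := rfl
@[simp] theorem mul_z (g h : Heisenberg) : (g * h).z = g.z + h.z + g.x * h.y := rfl
@[simp] theorem one_x : (1 : Heisenberg).x = 0 := rfl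
@[simp] theorem one_y : (1 : Heisenberg).y = 0 := rfl
@[simp] theorem one_z : (1 : Heisenberg).z = 0 := rfl
@[simp] theorem inv_x (g : Heisenberg) : (g⁻¹).x = -g.x := rfl
@[simp] theorem inv_y (g : Heisenberg) : (g⁻¹).y = -g.y := rfl
@[simp] theorem inv_z (g : Heisenberg) : (g⁻¹).z = -g.z + g.x * g.y := rfl

instance : Group Heisenberg :=
  Group.ofLeftAxioms
    (fun g h k => by ext <;> simp <;> ring)
    (fun g => by ext <;> simp)
    (fun g => by ext <;> simp)

/-- The generator `a = (1, 0, 0)`. -/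
def a : Heisenberg := ⟨1, 0, 0⟩

/-- The generator `b = (0, 1, 0)`. -/
def b : Heisenberg := ⟨0, 1, 0⟩

/-- The central element `c = (0, 0, 1)`. -/
def c : Heisenberg := ⟨0, 0, 1⟩

/-- The operator `P_{μ₀}` of the southwest measure `μ₀ = δ_{a⁻¹} + δ_{b⁻¹}`. -/
def southwestOp (f : Heisenberg → ℝ) : Heisenberg → ℝ :=
  fun g => f (a⁻¹ * g) + f (b⁻¹ * g)

/-- `μ₀`-harmonic functions: `h = P_{μ₀} h`. -/
def IsHarmonic (h : Heisenberg → ℝ) : Prop :=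
  ∀ g, h g = southwestOp h g

/-- Positive function: nonnegative everywhere and not identically zero. -/
def IsPositive (h : Heisenberg → ℝ) : Prop :=
  (∀ g, 0 ≤ h g) ∧ h ≠ 0

/-- A positive harmonic function is extremal if it is not the sum of two non-proportional
positive harmonic functions. (Positive functions are nonzero, so proportionality of `h₁` and
`h₂` means that `h₂` is a scalar multiple of `h₁`.) -/
def IsExtremal (h : Heisenberg → ℝ) : Prop :=
  IsPositive h ∧ IsHarmonic h ∧
    ∀ h₁ h₂ : Heisenberg → ℝ, IsPositive h₁ → IsHarmonic h₁ → IsPositive h₂ → IsHarmonic h₂ →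
      h = h₁ + h₂ → ∃ t : ℝ, h₂ = t • h₁

/-- `h (a⁻ⁿ g₀) → 0` and `h (b⁻ⁿ g₀) → 0` as `n → ∞`, for every `g₀`. -/
def DecaysOnCosets (h : Heisenberg → ℝ) : Prop :=
  ∀ g₀ : Heisenberg,
    Tendsto (fun n : ℕ => h (a ^ (-(n : ℤ)) * g₀)) atTop (𝓝 0) ∧
    Tendsto (fun n : ℕ => h (b ^ (-(n : ℤ)) * g₀)) atTop (𝓝 0)

/-- A character is a group homomorphism to the multiplicative group of positive reals. -/
def IsCharacter (χ : Heisenberg → ℝ) : Prop :=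
  (∀ g, 0 < χ g) ∧ ∀ g g', χ (g * g') = χ g * χ g'

end Heisenberg

/-! Put α = a⁻¹ and β = b⁻¹, so that βα = c⁻¹αβ. Iterating harmonicity writes h g as the sum of h (w
g) over all words w of a given length in α and β, and replacing a factor αβ of w by βα multiplies w
by the central element c⁻¹.

Among words with at least M factors αβ, share the value of each word equally among these factors and
send each share to the word with that factor swapped. A word has almost as many factors βα as αβ, so
the shares it receives overcount by at most 1 + 4/M, and these words contribute at most (1 + 4/M) h
(c g). Words with fewer than M factors αβ consist of boundedly many runs, and the decay condition
makes their contribution vanish as the length grows. Letting M → ∞ gives h g ≤ h (c g); exchanging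
the roles of α and β gives the reverse inequality.

Once h ignores c, translations by α and β commute on it. Both summands of h g = h (α g) + h (β g)
are then harmonic, so extremality makes them proportional, which forces a character. Conversely, a
harmonic function below a harmonic character χ inherits decay, hence central invariance; its
quotient by χ is bounded and harmonic for a probability measure, and a Choquet–Deny argument shows
that it is constant. -/

namespace SouthwestWalk

open Finset

variable {G : Type*} [Group G]

/-! ### Two-letter words and their ascents -/

/-- The product of the first `n` letters of the word with letter `β` at the positions in `s`
and letter `α` elsewhere. -/
def word (α β : G) (s : Finset ℕ) : ℕ → G
  | 0 => 1
  | n + 1 => word α β s n * if n ∈ s then β else α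

theorem word_congr (α β : G) {s t : Finset ℕ} {n : ℕ} (hst : ∀ i < n, i ∈ s ↔ i ∈ t) :
    word α β s n = word α β t n := by
  induction n with
  | zero => rfl
  | succ n ih =>
    simp only [word, ih fun i hi => hst i (hi.trans n.lt_succ_self), hst n n.lt_succ_self]

theorem word_insert (α β : G) (s : Finset ℕ) (n : ℕ) :
    word α β (insert n s) n = word α β s n :=
  word_congr α β fun i hi => by simp [hi.ne]

/-- Number of positions where a letter `α` is followed by a letter `β`. -/
def ascents (n : ℕ) (s : Finset ℕ) : ℕ := #{i ∈ range n | i ∉ s ∧ i + 1 ∈ s}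

/-- Number of positions where a letter `β` is followed by a letter `α`. -/
def descents (n : ℕ) (s : Finset ℕ) : ℕ := #{i ∈ range n | i ∈ s ∧ i + 1 ∉ s}

theorem ascents_succ (n : ℕ) (s : Finset ℕ) :
    ascents (n + 1) s = ascents n s + if n ∉ s ∧ n + 1 ∈ s then 1 else 0 := by
  unfold ascents
  rw [range_add_one, filter_insert]
  split_ifs <;> simp

theorem descents_succ (n : ℕ) (s : Finset ℕ) :
    descents (n + 1) s = descents n s + if n ∈ s ∧ n + 1 ∉ s then 1 else 0 := by
  unfold descents
  rw [range_add_one, filter_insert]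
  split_ifs <;> simp

/-- The two kinds of letter change alternate along a word, so their counts differ only through its
first and last letters. -/
theorem descents_add_eq (n : ℕ) (s : Finset ℕ) :
    descents n s + (if n ∈ s then 1 else 0) = ascents n s + if 0 ∈ s then 1 else 0 := by
  induction n with
  | zero => simp [ascents, descents]
  | succ n ih =>
    rw [ascents_succ, descents_succ]
    by_cases h1 : n ∈ s <;> by_cases h2 : n + 1 ∈ s <;> simp [h1, h2] at ih ⊢ <;> omega

theorem descents_le (n : ℕ) (s : Finset ℕ) : descents n s ≤ ascents n s + 1 := by
  have := descents_add_eq n s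
  split_ifs at this <;> omega

theorem ascents_congr {s t : Finset ℕ} {n : ℕ} (hst : ∀ i ≤ n, i ∈ s ↔ i ∈ t) :
    ascents n s = ascents n t := by
  unfold ascents
  congr 1
  refine filter_congr fun i hi => ?_
  have := mem_range.1 hi
  rw [hst i (by omega), hst (i + 1) (by omega)]

/-! ### Exchanging adjacent letters -/

/-- Exchange the letters at positions `i` and `i + 1`. -/
def exchange (i : ℕ) (s : Finset ℕ) : Finset ℕ := s.map (Equiv.swap i (i + 1)).toEmbedding

theorem mem_exchange {i j : ℕ} {s : Finset ℕ} :
    j ∈ exchange i s ↔ Equiv.swap i (i + 1) j ∈ s := by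
  simp [exchange, Finset.mem_map_equiv]

theorem exchange_exchange (i : ℕ) (s : Finset ℕ) : exchange i (exchange i s) = s := by
  ext j; simp [mem_exchange]

theorem left_mem_exchange {i : ℕ} {s : Finset ℕ} : i ∈ exchange i s ↔ i + 1 ∈ s := by
  simp [mem_exchange]

theorem right_mem_exchange {i : ℕ} {s : Finset ℕ} : i + 1 ∈ exchange i s ↔ i ∈ s := by
  simp [mem_exchange]

theorem mem_exchange_of_ne {i j : ℕ} {s : Finset ℕ} (h₁ : j ≠ i) (h₂ : j ≠ i + 1) :
    j ∈ exchange i s ↔ j ∈ s := by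
  rw [mem_exchange, Equiv.swap_apply_of_ne_of_ne h₁ h₂]

theorem exchange_subset_range {i n : ℕ} {s : Finset ℕ} (hi : i < n) (hs : s ⊆ range (n + 1)) :
    exchange i s ⊆ range (n + 1) := by
  intro j hj
  by_cases h₁ : j = i
  · simp [h₁]; omega
  by_cases h₂ : j = i + 1
  · simp [h₂]; omega
  exact hs ((mem_exchange_of_ne h₁ h₂).1 hj)

theorem ascents_le_exchange (n i : ℕ) (s : Finset ℕ) :
    ascents n s ≤ ascents n (exchange i s) + 3 := by
  -- An ascent at `j` depends only on the letters `j` and `j + 1`, so only these three positions can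
  -- be affected.
  have hsub : ({j ∈ range n | j ∉ s ∧ j + 1 ∈ s} : Finset ℕ) ⊆
      {j ∈ range n | j ∉ exchange i s ∧ j + 1 ∈ exchange i s} ∪ {i - 1, i, i + 1} := by
    intro j hj
    simp only [mem_union, mem_filter, mem_insert, mem_singleton] at hj ⊢
    by_cases h : j = i - 1 ∨ j = i ∨ j = i + 1
    · exact Or.inr h
    · refine Or.inl ?_
      rw [mem_exchange_of_ne (by omega) (by omega), mem_exchange_of_ne (by omega) (by omega)]
      exact hj
  exact (card_le_card hsub).trans ((card_union_le _ _).trans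
    (Nat.add_le_add_left card_le_three _))

theorem word_exchange {α β γ : G} (hγ : ∀ g, γ * g = g * γ) (hβα : β * α = γ * (α * β))
    {s : Finset ℕ} {i : ℕ} (h₁ : i ∉ s) (h₂ : i + 1 ∈ s) {n : ℕ} (hn : i + 2 ≤ n) :
    word α β (exchange i s) n = γ * word α β s n := by
  induction n, hn using Nat.le_induction with
  | base =>
    have : word α β (exchange i s) i = word α β s i :=
      word_congr α β fun j hj => mem_exchange_of_ne (by omega) (by omega)
    simp only [word, this, left_mem_exchange, right_mem_exchange, h₁, h₂, if_true, if_false]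
    rw [mul_assoc, hβα, ← mul_assoc, ← hγ]
    simp only [mul_assoc]
  | succ n hn ih =>
    simp only [word, ih, mem_exchange_of_ne (show n ≠ i by omega) (show n ≠ i + 1 by omega),
      mul_assoc]

/-! ### Harmonic functions as sums over words -/

section

variable {α β γ : G} {h : G → ℝ}

theorem sum_word (hh : ∀ g, h g = h (α * g) + h (β * g)) (n : ℕ) (g : G) :
    ∑ s ∈ (range n).powerset, h (word α β s n * g) = h g := by
  induction n generalizing g with
  | zero => simp [word]
  | succ n ih =>
    -- Letter `n` is the one next to `g`, so splitting on `n ∈ s` is harmonicity at `g`.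
    rw [range_add_one, sum_powerset_insert notMem_range_self, hh g, ← ih (α * g), ← ih (β * g)]
    congr 1
    · refine sum_congr rfl fun s hs => ?_
      have : n ∉ s := fun hn => notMem_range_self (mem_powerset.1 hs hn)
      simp [word, this, mul_assoc]
    · refine sum_congr rfl fun s _ => ?_
      simp [word, word_insert, mul_assoc]

/-- A double count: each word shares its value equally among its ascents, and exchanging at an
ascent is a bijection onto words with a descent at the same place. -/
theorem sum_many_ascents_le (h0 : ∀ g, 0 ≤ h g) (hh : ∀ g, h g = h (α * g) + h (β * g))
    (hγ : ∀ g, γ * g = g * γ) (hβα : β * α = γ * (α * β)) {M : ℕ} (hM : 0 < M) (n : ℕ) (g : G) :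
    ∑ s ∈ (range (n + 1)).powerset with M ≤ ascents n s, h (word α β s (n + 1) * g) ≤
      (1 + 4 / M) * h (γ⁻¹ * g) := by
  have hM' : (0 : ℝ) < M := by exact_mod_cast hM
  have hK : (0 : ℝ) ≤ 1 + 4 / M := by positivity
  set P := (range (n + 1)).powerset with hP
  let F : Finset ℕ → ℝ := fun s =>
    if M ≤ ascents n s then h (word α β s (n + 1) * g) / ascents n s else 0
  let H : Finset ℕ → ℝ := fun s => h (word α β s (n + 1) * (γ⁻¹ * g))
  calc ∑ s ∈ P with M ≤ ascents n s, h (word α β s (n + 1) * g)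
      = ∑ s ∈ P, ∑ i ∈ range n with (i ∉ s ∧ i + 1 ∈ s), F s := by
        rw [sum_filter]
        refine sum_congr rfl fun s _ => ?_
        rw [sum_const, nsmul_eq_mul]
        change _ = (ascents n s : ℝ) * F s
        by_cases hs : M ≤ ascents n s
        · have : (ascents n s : ℝ) ≠ 0 := by
            have : 0 < ascents n s := by omega
            positivity
          simp only [F, hs, if_true]
          field_simp
        · simp [F, hs]
    _ = ∑ i ∈ range n, ∑ s ∈ P with (i ∉ s ∧ i + 1 ∈ s), F s := by
        simp only [sum_filter]; exact sum_comm
    _ = ∑ i ∈ range n, ∑ s ∈ P with (i ∈ s ∧ i + 1 ∉ s), F (exchange i s) := by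
        refine sum_congr rfl fun i hi => ?_
        have hi := mem_range.1 hi
        refine sum_nbij' (exchange i) (exchange i) ?_ ?_ ?_ ?_ ?_
        · intro s hs
          simp only [hP, mem_filter, mem_powerset, left_mem_exchange, right_mem_exchange] at hs ⊢
          exact ⟨exchange_subset_range hi hs.1, hs.2.2, hs.2.1⟩
        · intro s hs
          simp only [hP, mem_filter, mem_powerset, left_mem_exchange, right_mem_exchange] at hs ⊢
          exact ⟨exchange_subset_range hi hs.1, hs.2.2, hs.2.1⟩
        · intro s _; exact exchange_exchange i s
        · intro s _; exact exchange_exchange i s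
        · intro s _; simp only [exchange_exchange]
    _ ≤ ∑ i ∈ range n, ∑ s ∈ P with (i ∈ s ∧ i + 1 ∉ s), (1 + 4 / M) * H s / descents n s := by
        refine sum_le_sum fun i hi => sum_le_sum fun s hs => ?_
        have hi' := mem_range.1 hi
        obtain ⟨_, h₁, h₂⟩ := mem_filter.1 hs
        have hd : 0 < descents n s := card_pos.2 ⟨i, mem_filter.2 ⟨hi, h₁, h₂⟩⟩
        have hd' : (0 : ℝ) < descents n s := by exact_mod_cast hd
        simp only [F]
        split_ifs with hs'
        · have hw : word α β (exchange i s) (n + 1) * g = word α β s (n + 1) * (γ⁻¹ * g) := by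
            have := word_exchange hγ hβα (s := exchange i s) (i := i) (n := n + 1)
              (by rwa [left_mem_exchange]) (by rwa [right_mem_exchange]) (by omega)
            rw [exchange_exchange] at this
            rw [this, hγ]
            group
          rw [hw]
          change H s / _ ≤ _
          -- The 4 is 3 for ascents changed by the exchange plus 1 for descents against ascents.
          have hle : descents n s ≤ ascents n (exchange i s) + 4 :=
            (descents_le n s).trans (by have := ascents_le_exchange n i s; omega)
          have hle' : (descents n s : ℝ) ≤ ascents n (exchange i s) + 4 := by exact_mod_cast hle
          have hMA : (M : ℝ) ≤ ascents n (exchange i s) := by exact_mod_cast hs'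
          have hA : (0 : ℝ) < ascents n (exchange i s) := hM'.trans_le hMA
          have hq : 4 ≤ 4 / (M : ℝ) * ascents n (exchange i s) := by
            rw [div_mul_eq_mul_div, le_div_iff₀ hM']
            linarith
          rw [div_le_div_iff₀ hA hd', mul_comm (1 + 4 / (M : ℝ)), mul_assoc]
          refine mul_le_mul_of_nonneg_left ?_ (h0 _)
          linarith
        · exact div_nonneg (mul_nonneg hK (h0 _)) hd'.le
    _ = ∑ s ∈ P, ∑ i ∈ range n with (i ∈ s ∧ i + 1 ∉ s), (1 + 4 / M) * H s / descents n s := by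
        simp only [sum_filter]; exact sum_comm
    _ ≤ ∑ s ∈ P, (1 + 4 / M) * H s := by
        refine sum_le_sum fun s _ => ?_
        rw [sum_const, nsmul_eq_mul]
        change (descents n s : ℝ) * _ ≤ _
        rcases Nat.eq_zero_or_pos (descents n s) with hd | hd
        · simpa [hd] using mul_nonneg hK (h0 _)
        · have : (descents n s : ℝ) ≠ 0 := by positivity
          exact (mul_div_cancel₀ _ this).le
    _ = (1 + 4 / M) * h (γ⁻¹ * g) := by rw [← mul_sum, sum_word hh]

/-! ### Words with few ascents -/

/-- Contribution of the words with fewer than `M` ascents whose last letter is `α`. -/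
noncomputable def fewEndLeft (α β : G) (h : G → ℝ) (M n : ℕ) (g : G) : ℝ :=
  ∑ s ∈ (range n).powerset, if ascents n s < M then h (word α β s n * (α * g)) else 0

/-- Contribution of the words with fewer than `M` ascents whose last letter is `β`. -/
noncomputable def fewEndRight (α β : G) (h : G → ℝ) (M n : ℕ) (g : G) : ℝ :=
  ∑ s ∈ (range n).powerset,
    if ascents n (insert n s) < M then h (word α β s n * (β * g)) else 0

theorem sum_few_ascents (M n : ℕ) (g : G) :
    ∑ s ∈ (range (n + 1)).powerset with ascents n s < M, h (word α β s (n + 1) * g) =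
      fewEndLeft α β h M n g + fewEndRight α β h M n g := by
  rw [sum_filter, range_add_one, sum_powerset_insert notMem_range_self]
  congr 1
  · refine sum_congr rfl fun s hs => ?_
    have : n ∉ s := fun hn => notMem_range_self (mem_powerset.1 hs hn)
    simp [word, this, mul_assoc]
  · refine sum_congr rfl fun s _ => ?_
    simp [word, word_insert, mul_assoc]

/-- A final `α` never creates an ascent, so the bound `M` is unchanged. -/
theorem fewEndLeft_succ (M n : ℕ) (g : G) :
    fewEndLeft α β h M (n + 1) g =
      fewEndLeft α β h M n (α * g) + fewEndRight α β h M n (α * g) := by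
  rw [fewEndLeft, range_add_one, sum_powerset_insert notMem_range_self]
  congr 1
  · refine sum_congr rfl fun s hs => ?_
    have h₁ : n ∉ s := fun hn => notMem_range_self (mem_powerset.1 hs hn)
    have h₂ : n + 1 ∉ s := fun hn => by simpa using mem_powerset.1 hs hn
    simp [word, ascents_succ, h₁, h₂, mul_assoc]
  · refine sum_congr rfl fun s hs => ?_
    have h₂ : n + 1 ∉ s := fun hn => by simpa using mem_powerset.1 hs hn
    simp [word, word_insert, ascents_succ, h₂, mul_assoc]

/-- A final `β` creates an ascent exactly when the previous letter is `α`; only then does the bound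
drop to `M`. -/
theorem fewEndRight_succ (M n : ℕ) (g : G) :
    fewEndRight α β h (M + 1) (n + 1) g =
      fewEndLeft α β h M n (β * g) + fewEndRight α β h (M + 1) n (β * g) := by
  rw [fewEndRight, range_add_one, sum_powerset_insert notMem_range_self]
  congr 1
  · refine sum_congr rfl fun s hs => ?_
    have h₁ : n ∉ s := fun hn => notMem_range_self (mem_powerset.1 hs hn)
    have h₂ : ascents n (insert (n + 1) s) = ascents n s :=
      ascents_congr fun i hi => by simp; omega
    simp [word, ascents_succ, h₁, h₂, mul_assoc]
  · refine sum_congr rfl fun s hs => ?_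
    have h₂ : ascents n (insert (n + 1) (insert n s)) = ascents n (insert n s) :=
      ascents_congr fun i hi => by simp; omega
    simp [word, word_insert, ascents_succ, h₂, mul_assoc]

theorem fewEndLeft_nonneg (h0 : ∀ g, 0 ≤ h g) (M n : ℕ) (g : G) :
    0 ≤ fewEndLeft α β h M n g :=
  sum_nonneg fun s _ => by split_ifs <;> simp [h0]

theorem fewEndRight_nonneg (h0 : ∀ g, 0 ≤ h g) (M n : ℕ) (g : G) :
    0 ≤ fewEndRight α β h M n g :=
  sum_nonneg fun s _ => by split_ifs <;> simp [h0]

theorem fewEndLeft_le (h0 : ∀ g, 0 ≤ h g) (hh : ∀ g, h g = h (α * g) + h (β * g)) (M n : ℕ)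
    (g : G) : fewEndLeft α β h M n g ≤ h g := by
  calc _ ≤ ∑ s ∈ (range n).powerset, h (word α β s n * (α * g)) :=
        sum_le_sum fun s _ => by split_ifs <;> simp [h0]
    _ = h (α * g) := sum_word hh n _
    _ ≤ h g := by rw [hh g]; linarith [h0 (β * g)]

theorem fewEndRight_le (h0 : ∀ g, 0 ≤ h g) (hh : ∀ g, h g = h (α * g) + h (β * g)) (M n : ℕ)
    (g : G) : fewEndRight α β h M n g ≤ h g := by
  calc _ ≤ ∑ s ∈ (range n).powerset, h (word α β s n * (β * g)) :=
        sum_le_sum fun s _ => by split_ifs <;> simp [h0]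
    _ = h (β * g) := sum_word hh n _
    _ ≤ h g := by rw [hh g]; linarith [h0 (α * g)]

/-- Unrolling `k` steps bounds `ψ n g` by `h (β ^ k * g)` up to `k` error terms that vanish as `n →
∞`; only afterwards is `k` taken large. -/
theorem tendsto_zero_of_recursion {ψ r : ℕ → G → ℝ} (hψ0 : ∀ n g, 0 ≤ ψ n g)
    (hψh : ∀ n g, ψ n g ≤ h g) (hrec : ∀ n g, ψ (n + 1) g = ψ n (β * g) + r n g)
    (hr : ∀ g, Tendsto (r · g) atTop (𝓝 0))
    (hβ : ∀ g, Tendsto (fun k : ℕ => h (β ^ k * g)) atTop (𝓝 0))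
    (g : G) : Tendsto (ψ · g) atTop (𝓝 0) := by
  have key : ∀ (k : ℕ) (ε : ℝ), 0 < ε → ∀ g, ∀ᶠ n in atTop, ψ n g ≤ h (β ^ k * g) + ε := by
    intro k
    induction k with
    | zero => intro ε hε g; exact .of_forall fun n => by simpa using (hψh n g).trans (by linarith)
    | succ k ih =>
      intro ε hε g
      rw [← map_add_atTop_eq_nat 1, eventually_map]
      filter_upwards [ih (ε / 2) (half_pos hε) (β * g),
        (hr g).eventually (ge_mem_nhds (half_pos hε))] with n h₁ h₂
      rw [hrec, pow_succ, mul_assoc]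
      linarith
  refine tendsto_order.2 ⟨fun a ha => .of_forall fun n => ha.trans_le (hψ0 n g), fun a ha => ?_⟩
  obtain ⟨k, hk⟩ := ((hβ g).eventually (gt_mem_nhds (half_pos ha))).exists
  filter_upwards [key k (a / 4) (by linarith) g] with n hn
  linarith

theorem tendsto_fewEnd (h0 : ∀ g, 0 ≤ h g) (hh : ∀ g, h g = h (α * g) + h (β * g))
    (hα : ∀ g, Tendsto (fun k : ℕ => h (α ^ k * g)) atTop (𝓝 0))
    (hβ : ∀ g, Tendsto (fun k : ℕ => h (β ^ k * g)) atTop (𝓝 0)) (M : ℕ) :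
    (∀ g, Tendsto (fewEndLeft α β h M · g) atTop (𝓝 0)) ∧
      ∀ g, Tendsto (fewEndRight α β h M · g) atTop (𝓝 0) := by
  induction M with
  | zero => simp [fewEndLeft, fewEndRight]
  | succ M ih =>
    -- Words ending in `β` come first: their source term has the smaller bound `M`, whereas the one
    -- for `α` is `fewEndRight` with the same bound `M + 1`.
    have hR : ∀ g, Tendsto (fewEndRight α β h (M + 1) · g) atTop (𝓝 0) :=
      tendsto_zero_of_recursion (r := fun n g => fewEndLeft α β h M n (β * g))
        (fewEndRight_nonneg h0 _) (fewEndRight_le h0 hh _)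
        (fun n g => (fewEndRight_succ M n g).trans (add_comm _ _)) (fun g => ih.1 (β * g)) hβ
    exact ⟨tendsto_zero_of_recursion (r := fun n g => fewEndRight α β h (M + 1) n (α * g))
      (fewEndLeft_nonneg h0 _) (fewEndLeft_le h0 hh _) (fewEndLeft_succ _) (fun g => hR (α * g)) hα,
      hR⟩

/-! ### Central invariance -/

theorem le_central_translate (h0 : ∀ g, 0 ≤ h g) (hh : ∀ g, h g = h (α * g) + h (β * g))
    (hγ : ∀ g, γ * g = g * γ) (hβα : β * α = γ * (α * β))
    (hα : ∀ g, Tendsto (fun k : ℕ => h (α ^ k * g)) atTop (𝓝 0))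
    (hβ : ∀ g, Tendsto (fun k : ℕ => h (β ^ k * g)) atTop (𝓝 0)) (g : G) :
    h g ≤ h (γ⁻¹ * g) := by
  have hM : ∀ M : ℕ, 0 < M → h g ≤ (1 + 4 / M) * h (γ⁻¹ * g) := by
    intro M hM
    obtain ⟨hL, hR⟩ := tendsto_fewEnd h0 hh hα hβ M
    have hlim := ((hL g).add (hR g)).add_const ((1 + 4 / M) * h (γ⁻¹ * g))
    rw [add_zero, zero_add] at hlim
    refine ge_of_tendsto' hlim fun n => ?_
    rw [← sum_few_ascents, ← sum_word hh (n + 1) g,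
      ← sum_filter_add_sum_filter_not _ (fun s => ascents n s < M)]
    simp only [not_lt]
    gcongr
    exact sum_many_ascents_le h0 hh hγ hβα hM n g
  have hlim : Tendsto (fun M : ℕ => (1 + 4 / (M : ℝ)) * h (γ⁻¹ * g)) atTop
      (𝓝 ((1 + 0) * h (γ⁻¹ * g))) :=
    ((tendsto_const_div_atTop_nhds_zero_nat 4).const_add 1).mul_const _
  rw [add_zero, one_mul] at hlim
  exact ge_of_tendsto hlim ((eventually_gt_atTop 0).mono hM)

/-- A nonnegative function with `h g = h (α g) + h (β g)` that decays along powers of `α` and `β`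
is invariant under the commutator of `α` and `β`, if that commutator is central. -/
theorem central_invariant (h0 : ∀ g, 0 ≤ h g) (hh : ∀ g, h g = h (α * g) + h (β * g))
    (hγ : ∀ g, γ * g = g * γ) (hβα : β * α = γ * (α * β))
    (hα : ∀ g, Tendsto (fun k : ℕ => h (α ^ k * g)) atTop (𝓝 0))
    (hβ : ∀ g, Tendsto (fun k : ℕ => h (β ^ k * g)) atTop (𝓝 0)) (g : G) :
    h (γ * g) = h g := by
  refine le_antisymm ?_ ?_
  · simpa using le_central_translate h0 hh hγ hβα hα hβ (γ * g)
  -- Interchanging `α` and `β` replaces the commutator `γ` by `γ⁻¹`.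
  · have hγ' : ∀ g, γ⁻¹ * g = g * γ⁻¹ := fun g => by
      rw [inv_mul_eq_iff_eq_mul, ← mul_assoc, hγ, mul_inv_cancel_right]
    simpa using le_central_translate h0 (fun g => (hh g).trans (add_comm _ _)) hγ'
      (by rw [hβα, inv_mul_cancel_left]) hβ hα g

/-! ### A Choquet–Deny argument -/

/-- A bounded harmonic function `u` for a two-point probability measure does not increase along
`α`, provided `u` sees `α` and `β` as commuting. -/
theorem bounded_harmonic_le {u : G → ℝ} {p q C : ℝ} (hp : 0 < p) (hq : 0 < q) (hpq : p + q = 1)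
    (h0 : ∀ g, 0 ≤ u g) (hC : ∀ g, u g ≤ C) (hu : ∀ g, u g = p * u (α * g) + q * u (β * g))
    (hcomm : ∀ g, u (α * (β * g)) = u (β * (α * g))) (g : G) : u (α * g) ≤ u g := by
  let e : G → ℝ := fun g => u (α * g) - u g
  have he : ∀ g, e g = p * e (α * g) + q * e (β * g) := fun g => by
    simp only [e]
    linear_combination hu (α * g) - hu g - q * hcomm g
  have hbdd : BddAbove (Set.range e) := ⟨C, by
    rintro _ ⟨g, rfl⟩
    simp only [e]
    linarith [hC (α * g), h0 g]⟩
  set S := sSup (Set.range e)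
  have heS : ∀ g, e g ≤ S := fun g => le_csSup hbdd ⟨g, rfl⟩
  by_contra! hlt
  have hSpos : 0 < S := (sub_pos.2 hlt).trans_le (heS g)
  -- Since `e` averages to itself and is at most `S`, a deficit below `S` grows by a factor of at
  -- most `1 / p` along `α`. Starting within `p ^ n * (S / 2)` keeps `e` above `S / 2` for `n`
  -- steps, and `u` then climbs past its bound.
  have hnear : ∀ (n : ℕ) (g : G), S - p ^ n * (S / 2) < e g → S / 2 < e (α ^ n * g) := by
    intro n
    induction n with
    | zero => intro g hg; simp at hg ⊢; linarith
    | succ n ih =>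
      intro g hg
      rw [pow_succ, mul_assoc]
      refine ih _ ?_
      have h₁ := he g
      have h₂ : q * e (β * g) ≤ q * S := mul_le_mul_of_nonneg_left (heS _) hq.le
      have h₃ : p * (S - p ^ n * (S / 2)) < p * e (α * g) := by
        have : q = 1 - p := by linarith
        rw [this] at h₁ h₂
        rw [pow_succ] at hg
        nlinarith
      exact lt_of_mul_lt_mul_left h₃ hp.le
  have htel : ∀ (n : ℕ) (g : G), S - p ^ n * (S / 2) < e g → n * (S / 2) ≤ u (α ^ n * g) - u g := by
    intro n
    induction n with
    | zero => intro g _; simp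
    | succ n ih =>
      intro g hg
      have hle : p ^ (n + 1) * (S / 2) ≤ p ^ n * (S / 2) := by
        refine mul_le_mul_of_nonneg_right ?_ (half_pos hSpos).le
        exact pow_le_pow_of_le_one hp.le (by linarith) n.le_succ
      have hg' : S - p ^ n * (S / 2) < e g := by linarith
      have h₁ := ih g hg'
      have h₂ := hnear n g hg'
      simp only [e] at h₂
      rw [← mul_assoc, ← pow_succ'] at h₂
      push_cast
      linarith
  obtain ⟨n, hn⟩ := exists_nat_gt (C / (S / 2))
  obtain ⟨_, ⟨g', rfl⟩, hg'⟩ := exists_lt_of_lt_csSup (Set.range_nonempty e)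
    (show S - p ^ n * (S / 2) < S by have : 0 < p ^ n * (S / 2) := by positivity
                                     linarith)
  have h₁ := htel n g' hg'
  rw [div_lt_iff₀ (half_pos hSpos)] at hn
  linarith [hC (α ^ n * g'), h0 g']

end

end SouthwestWalk

/-! ### The Heisenberg group and its center -/

namespace Heisenberg

theorem b_inv_mul_a_inv : b⁻¹ * a⁻¹ = c⁻¹ * (a⁻¹ * b⁻¹) := by
  ext <;> simp [a, b, c]

theorem c_inv_mul (g : Heisenberg) : c⁻¹ * g = g * c⁻¹ := by
  ext <;> simp [c, add_comm]

theorem c_zpow (n : ℤ) : c ^ n = ⟨0, 0, n⟩ := by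
  induction n with
  | zero => rfl
  | succ n ih => rw [zpow_add_one, ih]; ext <;> simp [c]
  | pred n ih => rw [zpow_sub_one, ih]; ext <;> simp [c]; ring

theorem center_eq_zpowers : Subgroup.center Heisenberg = Subgroup.zpowers c := by
  ext k
  rw [Subgroup.mem_center_iff, Subgroup.mem_zpowers_iff]
  constructor
  · intro hk
    have h₁ := congrArg z (hk a)
    have h₂ := congrArg z (hk b)
    simp [a, b] at h₁ h₂
    exact ⟨k.z, by rw [c_zpow]; ext <;> simp [h₁, h₂]⟩
  · rintro ⟨n, rfl⟩ g
    rw [c_zpow]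
    ext <;> simp [add_comm]

/-- Every element is a product of powers of `b`, `a` and `c`. -/
theorem induction_generators {p : Heisenberg → Prop} (one : p 1)
    (a_mul : ∀ g, p (a * g) ↔ p g) (b_mul : ∀ g, p (b * g) ↔ p g)
    (c_mul : ∀ g, p (c * g) ↔ p g) (g : Heisenberg) : p g := by
  have key : ∀ k : Heisenberg, (∀ g, p (k * g) ↔ p g) → ∀ (n : ℤ) g, p (k ^ n * g) ↔ p g := by
    intro k hk n
    induction n with
    | zero => simp
    | succ n ih => intro g; rw [zpow_add_one, mul_assoc, ih, hk]
    | pred n ih => intro g; rw [zpow_sub_one, mul_assoc, ih, ← hk, mul_inv_cancel_left]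
  have ha : ∀ n : ℤ, a ^ n = ⟨n, 0, 0⟩ := fun n => by
    induction n with
    | zero => rfl
    | succ n ih => rw [zpow_add_one, ih]; ext <;> simp [a]
    | pred n ih => rw [zpow_sub_one, ih]; ext <;> simp [a]; ring
  have hb : ∀ n : ℤ, b ^ n = ⟨0, n, 0⟩ := fun n => by
    induction n with
    | zero => rfl
    | succ n ih => rw [zpow_add_one, ih]; ext <;> simp [b]
    | pred n ih => rw [zpow_sub_one, ih]; ext <;> simp [b]; ring
  have hg : g = b ^ g.y * (a ^ g.x * (c ^ g.z * 1)) := by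
    rw [ha, hb, c_zpow]
    ext <;> simp
  rw [hg, key b b_mul, key a a_mul, key c c_mul]
  exact one

/-! ### Extremal functions and characters -/

variable {h : Heisenberg → ℝ}

theorem IsHarmonic.c_invariant (hpos : ∀ g, 0 ≤ h g) (hh : IsHarmonic h) (hd : DecaysOnCosets h)
    (g : Heisenberg) : h (c * g) = h g := by
  have := SouthwestWalk.central_invariant hpos hh c_inv_mul b_inv_mul_a_inv
    (fun g => by simpa [zpow_neg, inv_pow] using (hd g).1)
    (fun g => by simpa [zpow_neg, inv_pow] using (hd g).2) (c * g)
  rwa [inv_mul_cancel_left, eq_comm] at this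

theorem center_invariant (hc : ∀ g, h (c * g) = h g) {k : Heisenberg}
    (hk : k ∈ Subgroup.center Heisenberg) (g : Heisenberg) : h (g * k) = h g := by
  rw [Subgroup.mem_center_iff.1 hk g]
  rw [center_eq_zpowers, Subgroup.mem_zpowers_iff] at hk
  obtain ⟨n, rfl⟩ := hk
  induction n with
  | zero => simp
  | succ n ih => rw [zpow_add_one, (Commute.refl c).zpow_left n |>.eq, mul_assoc, hc, ih]
  | pred n ih =>
    rw [zpow_sub_one, ((Commute.refl c).inv_right.zpow_left _).eq, mul_assoc, ← hc,
      mul_inv_cancel_left, ih]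

theorem comm_of_c_invariant (hc : ∀ g, h (c * g) = h g) (g : Heisenberg) :
    h (a⁻¹ * (b⁻¹ * g)) = h (b⁻¹ * (a⁻¹ * g)) := by
  rw [← mul_assoc b⁻¹, b_inv_mul_a_inv, ← hc (c⁻¹ * _ * g)]
  simp only [mul_assoc, mul_inv_cancel_left]

theorem IsPositive.translate (hp : IsPositive h) (k : Heisenberg) :
    IsPositive fun g => h (k * g) := by
  refine ⟨fun g => hp.1 _, fun h0 => hp.2 (funext fun g => ?_)⟩
  simpa using congrFun h0 (k⁻¹ * g)

theorem eq_smul_character {p q : ℝ} (hp : 0 < p) (hq : 0 < q)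
    (ha : ∀ g, h (a * g) = p * h g) (hb : ∀ g, h (b * g) = q * h g)
    (hc : ∀ g, h (c * g) = h g) : ∃ χ : Heisenberg → ℝ, IsCharacter χ ∧ h = h 1 • χ := by
  refine ⟨fun g => p ^ g.x * q ^ g.y, ⟨fun g => by positivity, fun g g' => ?_⟩, ?_⟩
  · simp only [mul_x, mul_y, zpow_add₀ hp.ne', zpow_add₀ hq.ne']
    ring
  · ext g
    simp only [Pi.smul_apply, smul_eq_mul]
    induction g using induction_generators with
    | one => simp
    | a_mul g =>
      rw [ha, mul_x, mul_y, zpow_add₀ hp.ne']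
      simp only [a, zpow_one, zero_add]
      rw [show h 1 * (p * p ^ g.x * q ^ g.y) = p * (h 1 * (p ^ g.x * q ^ g.y)) by ring]
      exact mul_right_inj' hp.ne'
    | b_mul g =>
      rw [hb, mul_x, mul_y, zpow_add₀ hq.ne']
      simp only [b, zpow_one, zero_add]
      rw [show h 1 * (p ^ g.x * (q * q ^ g.y)) = q * (h 1 * (p ^ g.x * q ^ g.y)) by ring]
      exact mul_right_inj' hq.ne'
    | c_mul g => rw [hc]; simp [c]

theorem IsExtremal.eq_smul_character (he : IsExtremal h) (hd : DecaysOnCosets h) :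
    ∃ (t : ℝ) (χ : Heisenberg → ℝ), 0 < t ∧ IsCharacter χ ∧ h = t • χ := by
  obtain ⟨hpos, hh, hext⟩ := he
  have hc := hh.c_invariant hpos.1 hd
  have hcomm := comm_of_c_invariant hc
  have hA : IsHarmonic fun g => h (a⁻¹ * g) := fun g => by
    simp only [southwestOp]
    rw [hh (a⁻¹ * g), southwestOp, hcomm]
  have hB : IsHarmonic fun g => h (b⁻¹ * g) := fun g => by
    simp only [southwestOp]
    rw [hh (b⁻¹ * g), southwestOp, hcomm]
  -- Harmonicity itself is the decomposition to which extremality applies.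
  obtain ⟨t, ht⟩ := hext _ _ (hpos.translate a⁻¹) hA (hpos.translate b⁻¹) hB (funext hh)
  have ht' : ∀ g, h (b⁻¹ * g) = t * h (a⁻¹ * g) := fun g => congrFun ht g
  obtain ⟨g₁, hg₁⟩ := Function.ne_iff.1 (hpos.translate b⁻¹).2
  have htpos : 0 < t := by
    have h₁ : 0 < h (b⁻¹ * g₁) := (hpos.1 _).lt_of_ne' hg₁
    rw [ht'] at h₁
    exact pos_of_mul_pos_left h₁ (hpos.1 _)
  have ha : ∀ g, h (a * g) = (1 + t) * h g := fun g => by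
    rw [hh (a * g), southwestOp, ht', inv_mul_cancel_left]
    ring
  have hb : ∀ g, h (b * g) = ((1 + t) / t) * h g := fun g => by
    have h₁ := ht' (b * g)
    rw [inv_mul_cancel_left] at h₁
    have h₂ := ha (a⁻¹ * (b * g))
    rw [mul_inv_cancel_left] at h₂
    rw [h₂, h₁]
    field_simp
  obtain ⟨χ, hχ, hEq⟩ := Heisenberg.eq_smul_character (by positivity) (by positivity) ha hb hc
  refine ⟨h 1, χ, (hpos.1 1).lt_of_ne' fun h1 => hpos.2 ?_, hχ, hEq⟩
  rw [hEq, h1, zero_smul]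

theorem IsCharacter.map_one {χ : Heisenberg → ℝ} (hχ : IsCharacter χ) : χ 1 = 1 := by
  have := hχ.2 1 1
  rw [mul_one] at this
  exact (mul_eq_left₀ (hχ.1 1).ne').1 this.symm

theorem IsCharacter.map_pow {χ : Heisenberg → ℝ} (hχ : IsCharacter χ) (g : Heisenberg) (n : ℕ) :
    χ (g ^ n) = χ g ^ n := by
  induction n with
  | zero => simpa using hχ.map_one
  | succ n ih => rw [pow_succ, hχ.2, ih, pow_succ]

/-- At the identity, harmonicity of `χ` reads `χ a⁻¹ + χ b⁻¹ = 1`. Both values are thus below 1,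
which gives decay, and they are the weights for which `h / χ` is harmonic. -/
theorem IsCharacter.eq_smul_of_le {χ : Heisenberg → ℝ} (hχ : IsCharacter χ) (hχh : IsHarmonic χ)
    (h0 : ∀ g, 0 ≤ h g) (hh : IsHarmonic h) (hle : ∀ g, h g ≤ χ g) : h = h 1 • χ := by
  have hsum : χ a⁻¹ + χ b⁻¹ = 1 := by
    have := hχh 1
    rw [southwestOp, mul_one, mul_one, hχ.map_one] at this
    exact this.symm
  have hpa := hχ.1 a⁻¹
  have hpb := hχ.1 b⁻¹
  have hdecay : ∀ k : Heisenberg, χ k⁻¹ < 1 → ∀ g,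
      Tendsto (fun n : ℕ => h (k ^ (-(n : ℤ)) * g)) atTop (𝓝 0) := by
    intro k hk g
    have hlim := (tendsto_pow_atTop_nhds_zero_of_lt_one (hχ.1 k⁻¹).le hk).mul_const (χ g)
    rw [zero_mul] at hlim
    refine squeeze_zero (fun n => h0 _) (fun n => (hle _).trans_eq ?_) hlim
    rw [hχ.2, zpow_neg, zpow_natCast, ← inv_pow, hχ.map_pow]
  have hc := hh.c_invariant h0 fun g =>
    ⟨hdecay a (by linarith) g, hdecay b (by linarith) g⟩
  let u : Heisenberg → ℝ := fun g => h g / χ g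
  have hu0 : ∀ g, 0 ≤ u g := fun g => div_nonneg (h0 g) (hχ.1 g).le
  have hu1 : ∀ g, u g ≤ 1 := fun g => (div_le_one (hχ.1 g)).2 (hle g)
  have hu : ∀ g, u g = χ a⁻¹ * u (a⁻¹ * g) + χ b⁻¹ * u (b⁻¹ * g) := fun g => by
    have h₁ := (hχ.1 g).ne'
    simp only [u, hχ.2]
    rw [hh g, southwestOp]
    field_simp
  have hcomm : ∀ g, u (a⁻¹ * (b⁻¹ * g)) = u (b⁻¹ * (a⁻¹ * g)) := fun g => by
    simp only [u, comm_of_c_invariant hc g, hχ.2, mul_left_comm]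
  have hle_a := SouthwestWalk.bounded_harmonic_le hpa hpb hsum hu0 hu1 hu hcomm
  have hle_b := SouthwestWalk.bounded_harmonic_le hpb hpa ((add_comm _ _).trans hsum) hu0 hu1
    (fun g => (hu g).trans (add_comm _ _)) fun g => (hcomm g).symm
  -- `u` is a weighted mean of two translates, neither of which exceeds it, so both equal it.
  have hua : ∀ g, u (a * g) = u g := fun g => by
    have h₁ := hu (a * g)
    have h₂ := hle_a (a * g)
    have h₃ := mul_le_mul_of_nonneg_left (hle_b (a * g)) hpb.le
    rw [inv_mul_cancel_left] at h₁ h₂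
    have hq : χ b⁻¹ = 1 - χ a⁻¹ := by linarith
    rw [hq] at h₁ h₃
    refine le_antisymm ?_ h₂
    nlinarith
  have hub : ∀ g, u (b * g) = u g := fun g => by
    have h₁ := hu (b * g)
    have h₂ := hle_b (b * g)
    have h₃ := mul_le_mul_of_nonneg_left (hle_a (b * g)) hpa.le
    rw [inv_mul_cancel_left] at h₁ h₂
    have hq : χ a⁻¹ = 1 - χ b⁻¹ := by linarith
    rw [hq] at h₁ h₃
    refine le_antisymm ?_ h₂
    nlinarith
  have hconst : ∀ g, u g = u 1 := fun g => by
    have hab : ∀ g, u (c * g) = u g := fun g => by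
      rw [show c * g = a * (b * (a⁻¹ * (b⁻¹ * g))) by ext <;> simp [a, b, c]; ring]
      rw [hua, hub, ← hua, mul_inv_cancel_left, ← hub, mul_inv_cancel_left]
    induction g using induction_generators with
    | one => rfl
    | a_mul g => rw [hua]
    | b_mul g => rw [hub]
    | c_mul g => rw [hab]
  ext g
  have := hconst g
  simp only [u, hχ.map_one, div_one] at this
  rw [div_eq_iff (hχ.1 g).ne'] at this
  exact this

theorem IsCharacter.isExtremal {χ : Heisenberg → ℝ} (hχ : IsCharacter χ) (hχh : IsHarmonic χ) :
    IsExtremal χ := by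
  refine ⟨⟨fun g => (hχ.1 g).le, fun h0 => (hχ.1 1).ne' (congrFun h0 1)⟩, hχh, ?_⟩
  intro h₁ h₂ hp₁ hh₁ hp₂ hh₂ hadd
  have hsum : ∀ g, χ g = h₁ g + h₂ g := fun g => congrFun hadd g
  have e₁ := hχ.eq_smul_of_le hχh hp₁.1 hh₁ fun g => by linarith [hsum g, hp₂.1 g]
  have e₂ := hχ.eq_smul_of_le hχh hp₂.1 hh₂ fun g => by linarith [hsum g, hp₁.1 g]
  have hne : h₁ 1 ≠ 0 := fun h0 => hp₁.2 (by rw [e₁, h0, zero_smul])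
  refine ⟨h₂ 1 / h₁ 1, ?_⟩
  have e₃ : (h₂ 1 / h₁ 1) • h₁ = (h₂ 1 / h₁ 1) • h₁ 1 • χ := congrArg _ e₁
  rw [e₃, smul_smul, div_mul_cancel₀ _ hne]
  exact e₂

end Heisenberg

theorem lemma3p6 :
    Subgroup.center Heisenberg = Subgroup.zpowers Heisenberg.c ∧
    (∀ h : Heisenberg → ℝ, Heisenberg.IsPositive h → Heisenberg.IsHarmonic h →
      Heisenberg.DecaysOnCosets h →
      ∀ k ∈ Subgroup.center Heisenberg, ∀ g : Heisenberg, h (g * k) = h g) ∧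
    (∀ h : Heisenberg → ℝ, Heisenberg.IsExtremal h → Heisenberg.DecaysOnCosets h →
      ∃ (t : ℝ) (χ : Heisenberg → ℝ), 0 < t ∧ Heisenberg.IsCharacter χ ∧ h = t • χ) ∧
    (∀ χ : Heisenberg → ℝ, Heisenberg.IsCharacter χ → Heisenberg.IsHarmonic χ →
      Heisenberg.IsExtremal χ) :=
  ⟨Heisenberg.center_eq_zpowers,
    fun _ hp hh hd _ hk g => Heisenberg.center_invariant (hh.c_invariant hp.1 hd) hk g,
    fun _ he hd => he.eq_smul_character hd,
    fun _ hχ hh => hχ.isExtremal hh⟩
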